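/- Let $\gamma\in\mathbb{R}$ and consider the nongradient $\mathrm{sol}^3$ expanding Ricci soliton $(\mathcal{M}^3,g,X,4)$: $\mathcal{M}^3=\mathbb{R}^3$ with coordinates $(x_1,x_2,x_3)$, frame $F_1=2\partial_1$, $F_2=2(e^{-x_1}\partial_2+e^{x_1}\partial_3)$, $F_3=2(e^{-x_1}\partial_2-e^{x_1}\partial_3)$ with dual coframe $\varphi^1,\varphi^2,\varphi^3$, metric $g=4\varphi^1\otimes\varphi^1+8\varphi^2\otimes\varphi^2+8\varphi^3\otimes\varphi^3$ (that is, $g=dx_1^2+e^{2x_1}dx_2^2+e^{-2x_1}dx_3^2$), and vector field $$X=\gamma\left(-F_1-e^{-x_1}x_3F_2+e^{-x_1}x_3F_3\right)+(1-\gamma)\left(F_1-e^{x_1}x_2F_2-e^{x_1}x_2F_3\right).$$ Let $$Lh=\Delta_\ell h-\mathcal{L}_Xh-4h,\qquad (\Delta_\ell h)_{ij}=\Delta h_{ij}+2R_{ipqj}h^{pq}-R_i^kh_{kj}-R_j^kh_{ik},$$ be the linearization at $g$ (in the DeTurck gauge) of the modified Ricci flow $\partial_\tau g=-2\operatorname{Rc}(g)-\mathcal{L}_Xg-4g$,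 where $\Delta$ is the rough Laplacian, $\mathcal{L}_X$ the Lie derivative, and $R_{ijji}>0$ on round spheres. Write $(\delta h)_j=-\nabla^ih_{ij}$, let $\mu$ be the Riemannian measure of $g$ and $\|\cdot\|$ the $L^2(\mu)$ norm, and put $\omega=(5-\sqrt{17})/2$. Then $\omega>0$, and every smooth compactly supported symmetric $2$-tensor field $h$ on $\mathcal{M}^3$ satisfies $$\int\langle Lh,h\rangle\,d\mu\le-\|\delta h\|^2-\omega\|h\|^2 .$$ Moreover $L$ is strictly linearly stable: in the complexified $L^2$ space of symmetric $2$-tensor fields, the smooth compactly supported fields are dense, and there is $c>0$ such that the complexification $\mathbb{L}(v+iw)=Lv+iLw$ satisfies $\operatorname{Re}\,(\mathbb{L}u,u)_{L^2}\le-c\|u\|^2$ for all complex smooth compactly supported symmetric $2$-tensor fields $u$. -/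

import Mathlib

open scoped ContDiff
open MeasureTheory

/-!
Tensor calculus for a Riemannian metric on `ℝⁿ` in the global standard coordinates.
A metric is given by its matrix of components `g x`, a vector field by its components `X x k`,
a tensor field with two lower indices by its components `h x i j`.
-/

namespace CoordGeom

variable {n : ℕ}

/-- Partial derivative `∂ᵢ f`. -/
noncomputable def pd (i : Fin n) (f : (Fin n → ℝ) → ℝ) (x : Fin n → ℝ) : ℝ :=
  fderiv ℝ f x (Pi.single i 1)

/-- Christoffel symbol `Γᵏᵢⱼ` of the Levi-Civita connection of `g`. -/
noncomputable def christoffel (g : (Fin n → ℝ) → Matrix (Fin n) (Fin n) ℝ) (k i j : Fin n)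
    (x : Fin n → ℝ) : ℝ :=
  (1 / 2) * ∑ l, (g x)⁻¹ k l *
    (pd i (fun y => g y j l) x + pd j (fun y => g y i l) x - pd l (fun y => g y i j) x)

/-- The component `Rᵢⱼₖˡ` of the curvature, where `R(∂ᵢ, ∂ⱼ) ∂ₖ = Rᵢⱼₖˡ ∂ₗ` and
`R(U, V) W = ∇_U ∇_V W - ∇_V ∇_U W - ∇_[U, V] W`. -/
noncomputable def curv (g : (Fin n → ℝ) → Matrix (Fin n) (Fin n) ℝ) (i j k l : Fin n)
    (x : Fin n → ℝ) : ℝ :=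
  pd i (christoffel g l j k) x - pd j (christoffel g l i k) x
    + ∑ m, (christoffel g m j k x * christoffel g l i m x
      - christoffel g m i k x * christoffel g l j m x)

/-- `Rᵢⱼₖₗ = ⟨R(∂ᵢ, ∂ⱼ) ∂ₖ, ∂ₗ⟩`; with this convention `Rᵢⱼⱼᵢ` is positive on round spheres. -/
noncomputable def curvLow (g : (Fin n → ℝ) → Matrix (Fin n) (Fin n) ℝ) (i j k l : Fin n)
    (x : Fin n → ℝ) : ℝ :=
  ∑ m, curv g i j k m x * g x m l

/-- The Ricci tensor `Rⱼₖ = Rᵢⱼₖⁱ`. -/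
noncomputable def ricci (g : (Fin n → ℝ) → Matrix (Fin n) (Fin n) ℝ) (x : Fin n → ℝ)
    (j k : Fin n) : ℝ :=
  ∑ i, curv g i j k i x

/-- The covariant derivative `∇ₖ hᵢⱼ`. -/
noncomputable def nabla2 (g : (Fin n → ℝ) → Matrix (Fin n) (Fin n) ℝ)
    (h : (Fin n → ℝ) → Fin n → Fin n → ℝ) (x : Fin n → ℝ) (k i j : Fin n) : ℝ :=
  pd k (fun y => h y i j) x
    - ∑ m, (christoffel g m k i x * h x m j + christoffel g m k j x * h x i m)

/-- The covariant derivative `∇ₗ Tₖᵢⱼ` of a tensor field with three lower indices. -/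
noncomputable def nabla3 (g : (Fin n → ℝ) → Matrix (Fin n) (Fin n) ℝ)
    (T : (Fin n → ℝ) → Fin n → Fin n → Fin n → ℝ) (x : Fin n → ℝ) (l k i j : Fin n) : ℝ :=
  pd l (fun y => T y k i j) x
    - ∑ m, (christoffel g m l k x * T x m i j + christoffel g m l i x * T x k m j
      + christoffel g m l j x * T x k i m)

/-- The rough Laplacian `(Δ h)ᵢⱼ = gˡᵏ ∇ₗ ∇ₖ hᵢⱼ`. -/
noncomputable def roughLaplacian (g : (Fin n → ℝ) → Matrix (Fin n) (Fin n) ℝ)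
    (h : (Fin n → ℝ) → Fin n → Fin n → ℝ) (x : Fin n → ℝ) (i j : Fin n) : ℝ :=
  ∑ l, ∑ k, (g x)⁻¹ l k * nabla3 g (nabla2 g h) x l k i j

/-- The Lichnerowicz Laplacian
`(Δ_ℓ h)ᵢⱼ = Δ hᵢⱼ + 2 R_{ipqj} h^{pq} - Rᵢᵏ hₖⱼ - Rⱼᵏ hᵢₖ`. -/
noncomputable def lichnerowicz (g : (Fin n → ℝ) → Matrix (Fin n) (Fin n) ℝ)
    (h : (Fin n → ℝ) → Fin n → Fin n → ℝ) (x : Fin n → ℝ) (i j : Fin n) : ℝ :=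
  roughLaplacian g h x i j
    + 2 * ∑ p, ∑ q, curvLow g i p q j x *
        (∑ a, ∑ b, (g x)⁻¹ p a * (g x)⁻¹ q b * h x a b)
    - ∑ k, (∑ l, ricci g x i l * (g x)⁻¹ l k) * h x k j
    - ∑ k, (∑ l, ricci g x j l * (g x)⁻¹ l k) * h x i k

/-- The Lie derivative `(𝓛_X h)ᵢⱼ = Xᵏ ∂ₖ hᵢⱼ + ∂ᵢ Xᵏ hₖⱼ + ∂ⱼ Xᵏ hᵢₖ`. -/
noncomputable def lieDeriv (X : (Fin n → ℝ) → Fin n → ℝ)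
    (h : (Fin n → ℝ) → Fin n → Fin n → ℝ) (x : Fin n → ℝ) (i j : Fin n) : ℝ :=
  ∑ k, (X x k * pd k (fun y => h y i j) x + pd i (fun y => X y k) x * h x k j
    + pd j (fun y => X y k) x * h x i k)

/-- The linearization `L h = Δ_ℓ h - 𝓛_X h - α h` of the modified Ricci flow
`∂g/∂τ = -2 Rc(g) - 𝓛_X g - α g` at a soliton `(g, X, α)`, in the DeTurck gauge. -/
noncomputable def linOp (g : (Fin n → ℝ) → Matrix (Fin n) (Fin n) ℝ)
    (X : (Fin n → ℝ) → Fin n → ℝ) (α : ℝ)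
    (h : (Fin n → ℝ) → Fin n → Fin n → ℝ) (x : Fin n → ℝ) (i j : Fin n) : ℝ :=
  lichnerowicz g h x i j - lieDeriv X h x i j - α * h x i j

/-- The divergence `(δ h)ⱼ = -∇ⁱ hᵢⱼ`. -/
noncomputable def divergence (g : (Fin n → ℝ) → Matrix (Fin n) (Fin n) ℝ)
    (h : (Fin n → ℝ) → Fin n → Fin n → ℝ) (x : Fin n → ℝ) (j : Fin n) : ℝ :=
  -∑ k, ∑ i, (g x)⁻¹ k i * nabla2 g h x k i j

/-- The pointwise inner product `⟨θ, η⟩ = gⁱʲ θᵢ ηⱼ` of covectors at `x`. -/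
noncomputable def inner1 (g : (Fin n → ℝ) → Matrix (Fin n) (Fin n) ℝ) (x : Fin n → ℝ)
    (θ η : Fin n → ℝ) : ℝ :=
  ∑ i, ∑ j, (g x)⁻¹ i j * θ i * η j

/-- The pointwise inner product `⟨a, b⟩ = gⁱᵏ gʲˡ aᵢⱼ bₖₗ` of 2-tensors at `x`. -/
noncomputable def inner2 (g : (Fin n → ℝ) → Matrix (Fin n) (Fin n) ℝ) (x : Fin n → ℝ)
    (a b : Fin n → Fin n → ℝ) : ℝ :=
  ∑ i, ∑ j, ∑ k, ∑ l, (g x)⁻¹ i k * (g x)⁻¹ j l * a i j * b k l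

/-- The Riemannian volume measure `dμ = √(det g) dx`. -/
noncomputable def vol (g : (Fin n → ℝ) → Matrix (Fin n) (Fin n) ℝ) : Measure (Fin n → ℝ) :=
  volume.withDensity (fun x => ENNReal.ofReal (Real.sqrt (g x).det))

/-- Smooth compactly supported symmetric 2-tensor fields with values in `𝕜` (`ℝ` or `ℂ`),
i.e. the compactly supported infinitesimal variations of a metric and their
complexification. -/
structure IsTestTensor {𝕜 : Type} [RCLike 𝕜] (h : (Fin n → ℝ) → Fin n → Fin n → 𝕜) : Prop where
  smooth : ∀ i j, ContDiff ℝ ∞ (fun x => h x i j)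
  compactSupport : HasCompactSupport h
  symm : ∀ x i j, h x i j = h x j i

/-- The complexification `𝕃 (v + i w) = L v + i L w`. -/
noncomputable def linOpC (g : (Fin n → ℝ) → Matrix (Fin n) (Fin n) ℝ)
    (X : (Fin n → ℝ) → Fin n → ℝ) (α : ℝ)
    (u : (Fin n → ℝ) → Fin n → Fin n → ℂ) (x : Fin n → ℝ) (i j : Fin n) : ℂ :=
  (linOp g X α (fun y a b => (u y a b).re) x i j : ℂ)
    + Complex.I * (linOp g X α (fun y a b => (u y a b).im) x i j : ℂ)

/-- The pointwise Hermitian inner product `gⁱᵏ gʲˡ aᵢⱼ conj(bₖₗ)` of complex 2-tensors. -/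
noncomputable def inner2C (g : (Fin n → ℝ) → Matrix (Fin n) (Fin n) ℝ) (x : Fin n → ℝ)
    (a b : Fin n → Fin n → ℂ) : ℂ :=
  ∑ i, ∑ j, ∑ k, ∑ l,
    (((g x)⁻¹ i k * (g x)⁻¹ j l : ℝ) : ℂ) * a i j * (starRingEnd ℂ) (b k l)

/-- Strict linear stability of `L` at `(g, X, α)`: as an operator in the (complexified) `L²`
space of symmetric 2-tensor fields, with domain the smooth compactly supported ones, `L` is
densely defined and its numerical range lies in a half plane `Re z ≤ -c` with `c > 0`. -/
def StrictlyLinearlyStable (g : (Fin n → ℝ) → Matrix (Fin n) (Fin n) ℝ)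
    (X : (Fin n → ℝ) → Fin n → ℝ) (α : ℝ) : Prop :=
  (∀ f : (Fin n → ℝ) → Fin n → Fin n → ℂ, Measurable f → (∀ x i j, f x i j = f x j i) →
    (∫⁻ x, ENNReal.ofReal (inner2C g x (f x) (f x)).re ∂(vol g)) < ⊤ →
    ∀ ε : ℝ, 0 < ε → ∃ u : (Fin n → ℝ) → Fin n → Fin n → ℂ, IsTestTensor u ∧
      (∫⁻ x, ENNReal.ofReal (inner2C g x (f x - u x) (f x - u x)).re ∂(vol g))
        < ENNReal.ofReal ε) ∧
  ∃ c : ℝ, 0 < c ∧ ∀ u : (Fin n → ℝ) → Fin n → Fin n → ℂ, IsTestTensor u →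
    (∫ x, inner2C g x (linOpC g X α u x) (u x) ∂(vol g)).re
      ≤ -c * (∫ x, inner2C g x (u x) (u x) ∂(vol g)).re

end CoordGeom

/-! The `sol³` soliton on `ℝ³`; the coordinates `(x₁, x₂, x₃)` are `(x 0, x 1, x 2)`. -/

namespace Sol3

/-- The frame `F₁ = 2∂₁`, `F₂ = 2(e^{-x₁}∂₂ + e^{x₁}∂₃)`, `F₃ = 2(e^{-x₁}∂₂ - e^{x₁}∂₃)`;
`frame x a` lists the coordinate components of the `a`-th vector. -/
noncomputable def frame (x : Fin 3 → ℝ) : Fin 3 → Fin 3 → ℝ :=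
  ![![2, 0, 0],
    ![0, 2 * Real.exp (-x 0), 2 * Real.exp (x 0)],
    ![0, 2 * Real.exp (-x 0), -(2 * Real.exp (x 0))]]

/-- The dual coframe `φ¹ = dx₁/2`, `φ² = (e^{x₁}dx₂ + e^{-x₁}dx₃)/4`,
`φ³ = (e^{x₁}dx₂ - e^{-x₁}dx₃)/4`. -/
noncomputable def coframe (x : Fin 3 → ℝ) : Fin 3 → Fin 3 → ℝ :=
  ![![1 / 2, 0, 0],
    ![0, Real.exp (x 0) / 4, Real.exp (-x 0) / 4],
    ![0, Real.exp (x 0) / 4, -(Real.exp (-x 0) / 4)]]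

/-- The metric `g = 4 φ¹ ⊗ φ¹ + 8 φ² ⊗ φ² + 8 φ³ ⊗ φ³`. -/
noncomputable def metric (x : Fin 3 → ℝ) : Matrix (Fin 3) (Fin 3) ℝ :=
  Matrix.of fun i j => 4 * coframe x 0 i * coframe x 0 j + 8 * coframe x 1 i * coframe x 1 j
    + 8 * coframe x 2 i * coframe x 2 j

/-- The soliton vector field
`X = γ(-F₁ - e^{-x₁}x₃F₂ + e^{-x₁}x₃F₃) + (1 - γ)(F₁ - e^{x₁}x₂F₂ - e^{x₁}x₂F₃)`. -/
noncomputable def field (γ : ℝ) (x : Fin 3 → ℝ) (k : Fin 3) : ℝ :=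
  γ * (-frame x 0 k - Real.exp (-x 0) * x 2 * frame x 1 k
      + Real.exp (-x 0) * x 2 * frame x 2 k)
    + (1 - γ) * (frame x 0 k - Real.exp (x 0) * x 1 * frame x 1 k
      - Real.exp (x 0) * x 1 * frame x 2 k)

/-- The coframe is dual to the frame. -/
theorem coframe_frame (x : Fin 3 → ℝ) (a b : Fin 3) :
    ∑ k, coframe x a k * frame x b k = if a = b then 1 else 0 := by
  have h : Real.exp (x 0) * Real.exp (-x 0) = 1 := by rw [← Real.exp_add]; simp
  fin_cases a <;> fin_cases b <;> simp [coframe, frame, Fin.sum_univ_three] <;> linarith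

/-- In coordinates, `g = dx₁² + e^{2x₁} dx₂² + e^{-2x₁} dx₃²`. -/
theorem metric_eq (x : Fin 3 → ℝ) :
    metric x = Matrix.diagonal ![1, Real.exp (x 0) ^ 2, Real.exp (-x 0) ^ 2] := by
  ext i j
  fin_cases i <;> fin_cases j <;> simp [metric, coframe] <;> ring

/-- In coordinates, `X = γ(-2∂₁ - 4x₃∂₃) + (1 - γ)(2∂₁ - 4x₂∂₂)`. -/
theorem field_eq (γ : ℝ) (x : Fin 3 → ℝ) :
    field γ x = ![-2 * γ + 2 * (1 - γ), -4 * (1 - γ) * x 1, -4 * γ * x 2] := by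
  have h : Real.exp (x 0) * Real.exp (-x 0) = 1 := by rw [← Real.exp_add]; simp
  ext k
  fin_cases k
  · simp [field, frame]; ring
  · simp [field, frame]; linear_combination (-4 * (1 - γ) * x 1) * h
  · simp [field, frame]; linear_combination (-4 * γ * x 2) * h

end Sol3

/-!
In the left-invariant orthonormal frame `e₀ = ∂₁`, `e₁ = e^{-x₁}∂₂`, `e₂ = e^{x₁}∂₃` the Levi-Civita
connection and the curvature have constant coefficients, `[e₀, e₁] = -e₁`, `[e₀, e₂] = e₂`,
`[e₁, e₂] = 0`, and the Riemannian measure is Lebesgue measure, for which the `eₖ` are divergence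
free. Since the soliton field is affine in the coordinates, `𝓛_X` also acts on frame components by
`X` plus constants, and these constants, like `div X = -4`, do not depend on `γ`.

With `T_{ijk} = ∇ₖhᵢⱼ - ∇ᵢhₖⱼ`, writing `⟨Δh, h⟩` as a divergence minus `|∇h|²` and commuting
covariant derivatives gives the pointwise identity

  `⟨Lh, h⟩ = -|δh|² - |T|² / 2 + Q(h) + (divergence terms)`,

where the quadratic form `Q` (`reaction`) is algebraic in `h`: the Ricci terms of the Lichnerowicz
Laplacian cancel against `𝓛_X g = -2 Rc - 4 g`. The identity involves only the three frame
derivations and their commutators, so `koiso_identity` proves it for derivations of an arbitrary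
commutative algebra; it is then applied to the algebra `smoothFn` of smooth functions.
The lemmas `linOp_ofFrame2`, `divergence_ofFrame2` and `inner2_ofFrame2` translate the coordinate
expressions into frame components. The largest eigenvalue of `Q` is `-(5 - √17) / 2`
(`reaction_le`), and integrating gives the estimate (`integral_linOp_le`).

For complex `u = v + i w` the real part of `(𝕃u, u)` is the sum of the real quantities for `v` and
`w` (`re_integral_linOpC_le`), and density follows by approximating each frame component in `L²`
(`exists_testTensor_near`).
-/

namespace Sol3

open CoordGeom

/-! ### The Koiso-type identity in frame components -/

/-- The exponents of the warping functions: the coordinate covector `dxᵢ` has length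
`exp (-(expo i) * x₁)`. -/
def expo : Fin 3 → ℤ := ![0, 1, -1]

/-- The coefficients of the Levi-Civita connection in the orthonormal frame
`eᵢ = exp (-(expo i) * x₁) ∂ᵢ`, namely `∇_{eᵢ} eⱼ = ∑ₖ conn i j k • eₖ`. -/
def conn (i j k : Fin 3) : ℤ :=
  (if j = 0 ∧ i = k then expo k else 0) - (if k = 0 ∧ i = j then expo i else 0)

/-- The sectional curvatures of the planes spanned by two vectors of the orthonormal frame. -/
def sect : Fin 3 → Fin 3 → ℤ := ![![0, -1, -1], ![-1, 0, 1], ![-1, 1, 0]]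

/-- The curvature components `⟨R(eᵢ, eⱼ) eₖ, eₗ⟩` in the orthonormal frame. -/
def frameCurv (i j k l : Fin 3) : ℤ :=
  if j = k ∧ i = l then sect i j else if i = k ∧ j = l then -sect i j else 0

/-- The Ricci tensor in the orthonormal frame. -/
def frameRicci (j k : Fin 3) : ℤ := ∑ i, frameCurv i j k i

section Algebra

variable {A : Type*} [CommRing A] [Algebra ℝ A]

/-- Frame components of `∇ h`. -/
def frameCov2 (D : Fin 3 → Derivation ℝ A A) (H : Fin 3 → Fin 3 → A) (k i j : Fin 3) : A :=
  D k (H i j) - ∑ m, ((conn k i m : A) * H m j + (conn k j m : A) * H i m)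

/-- Frame components of `∇ T` for a tensor field `T` with three lower indices. -/
def frameCov3 (D : Fin 3 → Derivation ℝ A A) (T : Fin 3 → Fin 3 → Fin 3 → A)
    (l k i j : Fin 3) : A :=
  D l (T k i j) - ∑ m, ((conn l k m : A) * T m i j + (conn l i m : A) * T k m j
    + (conn l j m : A) * T k i m)

/-- Frame components of the divergence `δ h`. -/
def frameDiv (D : Fin 3 → Derivation ℝ A A) (H : Fin 3 → Fin 3 → A) (j : Fin 3) : A :=
  -∑ i, frameCov2 D H i i j

/-- Frame components of the Lichnerowicz Laplacian. -/
def frameLich (D : Fin 3 → Derivation ℝ A A) (H : Fin 3 → Fin 3 → A) (i j : Fin 3) : A :=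
  ∑ k, frameCov3 D (frameCov2 D H) k k i j
    + 2 * ∑ p, ∑ q, (frameCurv i p q j : A) * H p q
    - ∑ k, (frameRicci i k : A) * H k j - ∑ k, (frameRicci j k : A) * H i k

/-- Frame components of the Lie derivative along the soliton field: since the field is
affine in the coordinates, `[X, eᵢ]` is a constant multiple of `eᵢ`. -/
def frameLie (X : Derivation ℝ A A) (H : Fin 3 → Fin 3 → A) (i j : Fin 3) : A :=
  X (H i j) + (((![0, -2, -2] : Fin 3 → ℤ) i + (![0, -2, -2] : Fin 3 → ℤ) j : ℤ) : A) * H i j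

/-- Frame components of the linearized operator. -/
def frameLinOp (D : Fin 3 → Derivation ℝ A A) (X : Derivation ℝ A A) (H : Fin 3 → Fin 3 → A)
    (i j : Fin 3) : A :=
  frameLich D H i j - frameLie X H i j - 4 * H i j

/-- The vector field `Vₖ = hᵢⱼ∇ₖhᵢⱼ - hᵢⱼ∇ᵢhₖⱼ - (δh)ⱼhₖⱼ`. Its divergence is
`⟨Δh, h⟩ + |δh|² + ½ ∑ (∇ₖhᵢⱼ - ∇ᵢhₖⱼ)²` up to terms that are algebraic in `h`. -/
def bochnerField (D : Fin 3 → Derivation ℝ A A) (H : Fin 3 → Fin 3 → A) (k : Fin 3) : A :=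
  ∑ i, ∑ j, (frameCov2 D H k i j - frameCov2 D H i k j) * H i j - ∑ j, frameDiv D H j * H k j

/-- The quadratic form in `h` left over by the Koiso-type identity: the curvature terms together
with the zeroth-order part of `-𝓛_X - 4`. -/
def reaction (H : Fin 3 → Fin 3 → A) : A :=
  -2 * ∑ i, ∑ j, H i j * H i j
    - 2 * (H 0 0 * H 0 0 + H 0 0 * H 1 1 + H 0 0 * H 2 2 - H 1 1 * H 2 2 + H 1 2 * H 1 2)

/-- With `T_{ijk} = ∇ₖhᵢⱼ - ∇ᵢhₖⱼ`, this is the pointwise identity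
`2⟨Lh, h⟩ + 2|δh|² + |T|² = 2 Q(h) + 2 div V - div (|h|² X)`, where `V` is `bochnerField` and the last
divergence is expanded with `div X = -4`. It uses the derivations only through their commutators. -/
theorem koiso_identity (D : Fin 3 → Derivation ℝ A A) (X : Derivation ℝ A A)
    (hD01 : ∀ a, D 0 (D 1 a) = D 1 (D 0 a) - D 1 a)
    (hD02 : ∀ a, D 0 (D 2 a) = D 2 (D 0 a) + D 2 a)
    (hD12 : ∀ a, D 1 (D 2 a) = D 2 (D 1 a))
    (H : Fin 3 → Fin 3 → A) (hH : ∀ i j, H i j = H j i) :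
    2 * ∑ i, ∑ j, frameLinOp D X H i j * H i j + 2 * ∑ j, frameDiv D H j * frameDiv D H j
        + ∑ i, ∑ j, ∑ k, (frameCov2 D H k i j - frameCov2 D H i k j) ^ 2
      = 2 * reaction H + 2 * ∑ k, D k (bochnerField D H k)
        - (X (∑ i, ∑ j, H i j * H i j) - 4 * ∑ i, ∑ j, H i j * H i j) := by
  have h10 := hH 1 0
  have h20 := hH 2 0
  have h21 := hH 2 1
  simp [bochnerField, frameLinOp, frameLich, frameLie, frameDiv, frameCov3, frameCov2, frameCurv,
    frameRicci, sect, conn, expo, Fin.sum_univ_three, h10, h20, h21, reaction, Derivation.leibniz,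
    hD01, hD02, hD12]
  ring

end Algebra

/-! ### Smooth functions, the frame fields and their integrals -/

/-- The algebra of smooth real functions on `ℝ³`. -/
def smoothFn : Subalgebra ℝ ((Fin 3 → ℝ) → ℝ) where
  carrier := {f | ContDiff ℝ ∞ f}
  mul_mem' := fun {_ _} (hf : ContDiff ℝ ∞ _) (hg : ContDiff ℝ ∞ _) => hf.mul hg
  add_mem' := fun {_ _} (hf : ContDiff ℝ ∞ _) (hg : ContDiff ℝ ∞ _) => hf.add hg
  algebraMap_mem' := fun r => (contDiff_const : ContDiff ℝ ∞ fun _ : Fin 3 → ℝ => r)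

theorem contDiff_val (f : smoothFn) : ContDiff ℝ ∞ f.1 := f.2

theorem differentiableAt_val (f : smoothFn) (x : Fin 3 → ℝ) : DifferentiableAt ℝ f.1 x :=
  ((contDiff_val f).differentiable (by simp)).differentiableAt

theorem contDiff_pd {f : (Fin 3 → ℝ) → ℝ} (hf : ContDiff ℝ ∞ f) (k : Fin 3) :
    ContDiff ℝ ∞ (pd k f) :=
  (hf.fderiv_right (m := ∞) (by simp)).clm_apply contDiff_const

theorem pd_mul {f g : (Fin 3 → ℝ) → ℝ} {x : Fin 3 → ℝ} (hf : DifferentiableAt ℝ f x)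
    (hg : DifferentiableAt ℝ g x) (k : Fin 3) :
    pd k (fun y => f y * g y) x = f x * pd k g x + g x * pd k f x := by
  simp [pd, fderiv_fun_mul hf hg]

theorem pd_add {f g : (Fin 3 → ℝ) → ℝ} {x : Fin 3 → ℝ} (hf : DifferentiableAt ℝ f x)
    (hg : DifferentiableAt ℝ g x) (k : Fin 3) :
    pd k (fun y => f y + g y) x = pd k f x + pd k g x := by
  simp [pd, fderiv_fun_add hf hg]

theorem pd_const (c : ℝ) (k : Fin 3) (x : Fin 3 → ℝ) : pd k (fun _ => c) x = 0 := by
  simp [pd]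

theorem pd_coord (i k : Fin 3) (x : Fin 3 → ℝ) :
    pd k (fun y => y i) x = if i = k then 1 else 0 := by
  have : HasFDerivAt (fun y : Fin 3 → ℝ => y i) (ContinuousLinearMap.proj (R := ℝ) i) x :=
    (ContinuousLinearMap.proj (R := ℝ) (φ := fun _ : Fin 3 => ℝ) i).hasFDerivAt
  simp [pd, this.fderiv, Pi.single_apply]

theorem pd_comm {f : (Fin 3 → ℝ) → ℝ} (hf : ContDiff ℝ ∞ f) (i j : Fin 3) (x : Fin 3 → ℝ) :
    pd i (pd j f) x = pd j (pd i f) x := by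
  have hd : DifferentiableAt ℝ (fderiv ℝ f) x :=
    ((hf.fderiv_right (m := ∞) (by simp)).differentiable (by simp)).differentiableAt
  have key : ∀ a b : Fin 3,
      pd a (pd b f) x = fderiv ℝ (fderiv ℝ f) x (Pi.single a 1) (Pi.single b 1) := by
    intro a b
    change fderiv ℝ (fun y => fderiv ℝ f y (Pi.single b 1)) x (Pi.single a 1) = _
    rw [fderiv_clm_apply hd (differentiableAt_const _)]
    simp
  rw [key, key]
  exact (hf.contDiffAt.isSymmSndFDerivAt (by simpa using WithTop.coe_le_coe.2 (le_top : (2 : ℕ∞) ≤ ⊤))) _ _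

/-- The coordinate vector field `∂ₖ` as a derivation of the algebra of smooth functions. -/
noncomputable def coordDeriv (k : Fin 3) : Derivation ℝ smoothFn smoothFn :=
  Derivation.mk'
    { toFun := fun f => ⟨pd k f.1, contDiff_pd (contDiff_val f) k⟩
      map_add' := fun f g => Subtype.ext <| funext fun x =>
        pd_add (differentiableAt_val f x) (differentiableAt_val g x) k
      map_smul' := fun c f => Subtype.ext <| funext fun x => by
        have := pd_mul (differentiableAt_const c) (differentiableAt_val f x) k
        rw [pd_const, mul_zero, add_zero] at this
        exact this }
    (fun f g => Subtype.ext <| funext fun x =>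
      pd_mul (differentiableAt_val f x) (differentiableAt_val g x) k)

theorem coordDeriv_apply (k : Fin 3) (f : smoothFn) (x : Fin 3 → ℝ) :
    (coordDeriv k f).1 x = pd k f.1 x := rfl

/-- The warping functions `1, exp x₁, exp (-x₁)`: the vectors `(warp i)⁻¹ • ∂ᵢ` form an
orthonormal frame. -/
noncomputable def warp (i : Fin 3) : smoothFn :=
  ⟨fun x => Real.exp (expo i * x 0), by
    change ContDiff ℝ ∞ fun x : Fin 3 → ℝ => Real.exp (expo i * x 0)
    fun_prop⟩

/-- The inverses of the warping functions. -/
noncomputable def warpInv (i : Fin 3) : smoothFn :=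
  ⟨fun x => Real.exp (-(expo i * x 0)), by
    change ContDiff ℝ ∞ fun x : Fin 3 → ℝ => Real.exp (-(expo i * x 0))
    fun_prop⟩

theorem warp_mul_warpInv (i : Fin 3) (x : Fin 3 → ℝ) : (warp i).1 x * (warpInv i).1 x = 1 := by
  simp [warp, warpInv, ← Real.exp_add]

theorem warpInv_mul_warp (i : Fin 3) : warpInv i * warp i = 1 :=
  Subtype.ext <| funext fun x => by
    rw [mul_comm]; exact warp_mul_warpInv i x

theorem pd_exp_mul (c : ℝ) (k : Fin 3) (x : Fin 3 → ℝ) :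
    pd k (fun y => Real.exp (c * y 0)) x = if k = 0 then c * Real.exp (c * x 0) else 0 := by
  have h0 : HasFDerivAt (fun y : Fin 3 → ℝ => y 0) (ContinuousLinearMap.proj (R := ℝ) 0) x :=
    (ContinuousLinearMap.proj (R := ℝ) (φ := fun _ : Fin 3 => ℝ) 0).hasFDerivAt
  have h1 := (h0.const_mul c).exp
  simp only [pd, h1.fderiv]
  by_cases hk : k = 0 <;> simp [hk, mul_comm]

theorem coordDeriv_warp (k i : Fin 3) :
    coordDeriv k (warp i) = if k = 0 then ((expo i : ℤ) : smoothFn) * warp i else 0 := by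
  refine Subtype.ext <| funext fun x => ?_
  rw [coordDeriv_apply]
  refine (pd_exp_mul (expo i) k x).trans ?_
  split_ifs <;> rfl

theorem coordDeriv_warpInv (k i : Fin 3) :
    coordDeriv k (warpInv i) = if k = 0 then -((expo i : ℤ) : smoothFn) * warpInv i else 0 := by
  refine Subtype.ext <| funext fun x => ?_
  rw [coordDeriv_apply]
  have : (warpInv i).1 = fun y => Real.exp ((-expo i : ℝ) * y 0) := by
    ext y; simp [warpInv]
  rw [this, pd_exp_mul]
  split_ifs
  · simp [warpInv]
  · rfl

/-- The orthonormal frame field `eₖ = exp (-(expo k) * x₁) ∂ₖ` as a derivation. -/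
noncomputable def frameDeriv (k : Fin 3) : Derivation ℝ smoothFn smoothFn :=
  warpInv k • coordDeriv k

theorem frameDeriv_apply (k : Fin 3) (f : smoothFn) :
    frameDeriv k f = warpInv k * coordDeriv k f := rfl

theorem coordDeriv_eq (k : Fin 3) (f : smoothFn) :
    coordDeriv k f = warp k * frameDeriv k f := by
  rw [frameDeriv_apply, ← mul_assoc, mul_comm (warp k), warpInv_mul_warp, one_mul]

theorem coordDeriv_comm (i j : Fin 3) (f : smoothFn) :
    coordDeriv i (coordDeriv j f) = coordDeriv j (coordDeriv i f) :=
  Subtype.ext <| funext fun x => pd_comm (contDiff_val f) i j x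

theorem warpInv_zero : warpInv 0 = 1 :=
  Subtype.ext <| funext fun x => by simp [warpInv, expo]

theorem frameDeriv_zero_one (f : smoothFn) :
    frameDeriv 0 (frameDeriv 1 f) = frameDeriv 1 (frameDeriv 0 f) - frameDeriv 1 f := by
  simp [frameDeriv_apply, Derivation.leibniz, coordDeriv_warpInv, warpInv_zero, coordDeriv_comm 0 1, expo]
  ring

theorem frameDeriv_zero_two (f : smoothFn) :
    frameDeriv 0 (frameDeriv 2 f) = frameDeriv 2 (frameDeriv 0 f) + frameDeriv 2 f := by
  simp [frameDeriv_apply, Derivation.leibniz, coordDeriv_warpInv, warpInv_zero, coordDeriv_comm 0 2, expo]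
  ring

theorem frameDeriv_one_two (f : smoothFn) :
    frameDeriv 1 (frameDeriv 2 f) = frameDeriv 2 (frameDeriv 1 f) := by
  simp [frameDeriv_apply, Derivation.leibniz, coordDeriv_warpInv, coordDeriv_comm 1 2]
  ring

/-- The components of the soliton field as smooth functions. -/
noncomputable def fieldFn (γ : ℝ) (k : Fin 3) : smoothFn :=
  ⟨fun x => field γ x k, by
    change ContDiff ℝ ∞ fun x => field γ x k
    simp only [field_eq]
    fin_cases k <;> simp <;> fun_prop⟩

/-- The soliton field as a derivation. -/
noncomputable def fieldDeriv (γ : ℝ) : Derivation ℝ smoothFn smoothFn :=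
  ∑ k, fieldFn γ k • coordDeriv k

theorem fieldDeriv_apply (γ : ℝ) (f : smoothFn) :
    fieldDeriv γ f = ∑ k, fieldFn γ k * coordDeriv k f := by
  simp [fieldDeriv, Fin.sum_univ_three]

/-- The ideal of compactly supported functions in the algebra of smooth functions. -/
def compactlySupported : Ideal smoothFn where
  carrier := {f | HasCompactSupport f.1}
  add_mem' := fun hf hg => HasCompactSupport.add hf hg
  zero_mem' := HasCompactSupport.zero
  smul_mem' := fun c _ hf => HasCompactSupport.mul_left (f := c.1) hf

theorem integrable_of_mem {f : smoothFn} (hf : f ∈ compactlySupported) : Integrable f.1 :=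
  (contDiff_val f).continuous.integrable_of_hasCompactSupport hf

theorem coordDeriv_mem {f : smoothFn} (hf : f ∈ compactlySupported) (k : Fin 3) :
    coordDeriv k f ∈ compactlySupported :=
  HasCompactSupport.fderiv_apply (𝕜 := ℝ) (f := f.1) hf _

theorem integral_coordDeriv {f : smoothFn} (hf : f ∈ compactlySupported) (k : Fin 3) :
    ∫ x, (coordDeriv k f).1 x = 0 := by
  have h1 : Integrable (fun x => fderiv ℝ f.1 x (Pi.single k 1)) :=
    integrable_of_mem (coordDeriv_mem hf k)
  have := integral_mul_fderiv_eq_neg_fderiv_mul_of_integrable (μ := volume) (𝕜 := ℝ)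
    (f := fun _ : Fin 3 → ℝ => (1 : ℝ)) (g := f.1) (v := Pi.single k 1)
    (by simp) (by simpa using h1) (by simpa using integrable_of_mem hf)
    (fun x _ => differentiableAt_const _) (fun x _ => differentiableAt_val f x)
  simpa [coordDeriv_apply, pd] using this

theorem frameDeriv_mem {f : smoothFn} (hf : f ∈ compactlySupported) (k : Fin 3) :
    frameDeriv k f ∈ compactlySupported :=
  compactlySupported.mul_mem_left _ (coordDeriv_mem hf k)

/-- The frame fields are divergence free, because `warpInv k` does not depend on `xₖ`. -/
theorem integral_frameDeriv {f : smoothFn} (hf : f ∈ compactlySupported) (k : Fin 3) :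
    ∫ x, (frameDeriv k f).1 x = 0 := by
  have : frameDeriv k f = coordDeriv k (warpInv k * f) := by
    rw [Derivation.leibniz, coordDeriv_warpInv, frameDeriv_apply]
    fin_cases k <;> simp [expo]
  rw [this]
  exact integral_coordDeriv (compactlySupported.mul_mem_left _ hf) k

theorem coordDeriv_fieldFn (γ : ℝ) (i k : Fin 3) :
    (coordDeriv i (fieldFn γ k)) =
      algebraMap ℝ smoothFn (if i = k then (![0, -4 * (1 - γ), -4 * γ] : Fin 3 → ℝ) i else 0) := by
  refine Subtype.ext <| funext fun x => ?_
  rw [coordDeriv_apply]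
  change pd i (fun y => field γ y k) x = _
  simp only [field_eq]
  have h : ∀ c : ℝ, ∀ j, pd i (fun y => c * y j) x = c * if j = i then 1 else 0 := fun c j => by
    rw [pd_mul (differentiableAt_const _) (by fun_prop), pd_coord, pd_const]; simp
  have hc : ∀ y : Fin 3 → ℝ, ((algebraMap ℝ smoothFn (0:ℝ)).1 y) = 0 := fun y => rfl
  fin_cases k <;> fin_cases i <;>
    first
    | exact (pd_const _ _ _).trans (by simp)
    | exact (h _ _).trans (by simp)

/-- The soliton field has constant divergence `-4`. -/
theorem integral_fieldDeriv {f : smoothFn} (hf : f ∈ compactlySupported) (γ : ℝ) :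
    ∫ x, (fieldDeriv γ f - 4 * f).1 x = 0 := by
  have : fieldDeriv γ f - 4 * f = ∑ k, coordDeriv k (fieldFn γ k * f) := by
    have h4 : (4 : smoothFn) = algebraMap ℝ smoothFn 4 := (map_ofNat _ 4).symm
    simp only [fieldDeriv_apply, Derivation.leibniz, coordDeriv_fieldFn, smul_eq_mul,
      Fin.sum_univ_three, h4]
    simp
    ring
  rw [this]
  have h2 : ∀ x, (∑ k, coordDeriv k (fieldFn γ k * f)).1 x
      = ∑ k, (coordDeriv k (fieldFn γ k * f)).1 x := by
    intro x; simp [Fin.sum_univ_three]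
  have hm := fun k => compactlySupported.mul_mem_left (fieldFn γ k) hf
  simp only [h2]
  rw [integral_finsetSum _ fun k _ => integrable_of_mem (coordDeriv_mem (hm k) k)]
  exact Finset.sum_eq_zero fun k _ => integral_coordDeriv (hm k) k

/-! ### Frame components of tensors and covariant derivatives -/

theorem metric_apply (x : Fin 3 → ℝ) (i j : Fin 3) :
    metric x i j = if i = j then (warp i).1 x ^ 2 else 0 := by
  rw [metric_eq, Matrix.diagonal_apply]
  fin_cases i <;> simp [warp, expo]

theorem metric_inv (x : Fin 3 → ℝ) :
    (metric x)⁻¹ = Matrix.diagonal fun i => (warpInv i).1 x ^ 2 := by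
  refine Matrix.inv_eq_right_inv ?_
  ext i j
  have h := warp_mul_warpInv i x
  rw [Matrix.mul_diagonal, metric_apply, Matrix.one_apply]
  split_ifs with hij
  · subst hij
    rw [← mul_pow, h, one_pow]
  · simp

theorem metric_inv_apply (x : Fin 3 → ℝ) (i j : Fin 3) :
    (metric x)⁻¹ i j = if i = j then (warpInv i).1 x ^ 2 else 0 := by
  rw [metric_inv, Matrix.diagonal_apply]

theorem pd_metric (k i j : Fin 3) (x : Fin 3 → ℝ) :
    pd k (fun y => metric y i j) x =
      if i = j ∧ k = 0 then 2 * expo i * (warp i).1 x ^ 2 else 0 := by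
  by_cases hij : i = j
  · simp only [metric_apply, hij, if_true, true_and]
    have := congrArg (fun f : smoothFn => f.1 x) (Derivation.leibniz_pow (coordDeriv k) (warp j) 2)
    rw [coordDeriv_warp] at this
    refine this.trans ?_
    have h2 : (2 : smoothFn).1 x = 2 := rfl
    split_ifs
    · simp [h2]; ring
    · simp
  · simp [metric_apply, hij, pd_const]

theorem christoffel_metric (k i j : Fin 3) (x : Fin 3 → ℝ) :
    christoffel metric k i j x = (if i = 0 ∧ j = k then (expo k : ℝ) else 0)
      + conn i j k * ((warp i).1 x * (warp j).1 x * (warpInv k).1 x) := by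
  have h := warp_mul_warpInv k x
  have h0 : (warp 0).1 x = 1 := by simp [warp, expo]
  have h0' : (warpInv 0).1 x = 1 := by simp [warpInv, expo]
  have h1 := warp_mul_warpInv 1 x
  have h2 := warp_mul_warpInv 2 x
  simp only [christoffel, metric_inv_apply, pd_metric, conn]
  fin_cases k <;> fin_cases i <;> fin_cases j <;>
    simp [expo, h0, h0'] <;> grind

/-- The tensor field with frame components `H`, in coordinates. -/
noncomputable def ofFrame2 (H : Fin 3 → Fin 3 → smoothFn) (x : Fin 3 → ℝ) (i j : Fin 3) : ℝ :=
  (warp i * warp j * H i j).1 x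

/-- The tensor field with three lower indices and frame components `T`, in coordinates. -/
noncomputable def ofFrame3 (T : Fin 3 → Fin 3 → Fin 3 → smoothFn) (x : Fin 3 → ℝ)
    (k i j : Fin 3) : ℝ :=
  (warp k * warp i * warp j * T k i j).1 x

theorem val_add (f g : smoothFn) (x : Fin 3 → ℝ) : (f + g).1 x = f.1 x + g.1 x := rfl
theorem val_sub (f g : smoothFn) (x : Fin 3 → ℝ) : (f - g).1 x = f.1 x - g.1 x := rfl
theorem val_mul (f g : smoothFn) (x : Fin 3 → ℝ) : (f * g).1 x = f.1 x * g.1 x := rfl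
theorem val_neg (f : smoothFn) (x : Fin 3 → ℝ) : (-f).1 x = -f.1 x := rfl
theorem val_intCast (m : ℤ) (x : Fin 3 → ℝ) : (m : smoothFn).1 x = m := rfl
theorem val_sum {ι : Type*} (s : Finset ι) (f : ι → smoothFn) (x : Fin 3 → ℝ) :
    (∑ i ∈ s, f i).1 x = ∑ i ∈ s, (f i).1 x := by
  simp

/-- The part of the Christoffel contraction coming from the derivative of the warping functions
cancels against the Leibniz rule. -/
theorem sum_christoffel_mul (k i : Fin 3) (v : Fin 3 → ℝ) (x : Fin 3 → ℝ) :
    ∑ m, christoffel metric m k i x * ((warp m).1 x * v m) =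
      (if k = 0 then expo i * ((warp i).1 x * v i) else 0)
        + (warp k).1 x * (warp i).1 x * ∑ m, conn k i m * v m := by
  have h : ∀ m, christoffel metric m k i x * ((warp m).1 x * v m) =
      (if i = m then (if k = 0 then expo i * ((warp i).1 x * v i) else 0) else 0)
        + (warp k).1 x * (warp i).1 x * (conn k i m * v m) := by
    intro m
    rw [christoffel_metric]
    have := warp_mul_warpInv m x
    by_cases hk : k = 0 <;> by_cases hi : i = m <;> simp [hk, hi] <;> grind
  simp only [h, Finset.sum_add_distrib, ← Finset.mul_sum]
  simp

theorem nabla2_ofFrame2 (H : Fin 3 → Fin 3 → smoothFn) :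
    nabla2 metric (ofFrame2 H) = ofFrame3 (frameCov2 frameDeriv H) := by
  ext x k i j
  have hpd : pd k (fun y => ofFrame2 H y i j) x = (coordDeriv k (warp i * warp j * H i j)).1 x :=
    rfl
  have e1 : ∑ m, christoffel metric m k i x * ofFrame2 H x m j =
      (warp j).1 x * ∑ m, christoffel metric m k i x * ((warp m).1 x * (H m j).1 x) := by
    rw [Finset.mul_sum]
    refine Finset.sum_congr rfl fun m _ => ?_
    simp only [ofFrame2, val_mul]; ring
  have e2 : ∑ m, christoffel metric m k j x * ofFrame2 H x i m =
      (warp i).1 x * ∑ m, christoffel metric m k j x * ((warp m).1 x * (H i m).1 x) := by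
    rw [Finset.mul_sum]
    refine Finset.sum_congr rfl fun m _ => ?_
    simp only [ofFrame2, val_mul]; ring
  rw [nabla2, hpd, Finset.sum_add_distrib, e1, e2, sum_christoffel_mul, sum_christoffel_mul]
  simp only [ofFrame3, frameCov2, val_mul, val_sub, val_sum, val_add, val_intCast,
    Finset.sum_add_distrib, Derivation.leibniz, smul_eq_mul, coordDeriv_warp, coordDeriv_eq k (H i j)]
  by_cases hk : k = 0
  · simp only [hk, if_true, val_mul, val_intCast]; ring
  · simp only [hk, if_false]
    have h0 : (0 : smoothFn).1 x = 0 := rfl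
    rw [h0]; ring

theorem nabla3_ofFrame3 (T : Fin 3 → Fin 3 → Fin 3 → smoothFn) (x : Fin 3 → ℝ)
    (l k i j : Fin 3) :
    nabla3 metric (ofFrame3 T) x l k i j =
      (warp l * warp k * warp i * warp j * frameCov3 frameDeriv T l k i j).1 x := by
  have hpd : pd l (fun y => ofFrame3 T y k i j) x =
      (coordDeriv l (warp k * warp i * warp j * T k i j)).1 x := rfl
  have e0 : ∑ m, christoffel metric m l k x * ofFrame3 T x m i j = (warp i).1 x * (warp j).1 x *
      ∑ m, christoffel metric m l k x * ((warp m).1 x * (T m i j).1 x) := by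
    rw [Finset.mul_sum]
    refine Finset.sum_congr rfl fun m _ => ?_
    simp only [ofFrame3, val_mul]; ring
  have e1 : ∑ m, christoffel metric m l i x * ofFrame3 T x k m j = (warp k).1 x * (warp j).1 x *
      ∑ m, christoffel metric m l i x * ((warp m).1 x * (T k m j).1 x) := by
    rw [Finset.mul_sum]
    refine Finset.sum_congr rfl fun m _ => ?_
    simp only [ofFrame3, val_mul]; ring
  have e2 : ∑ m, christoffel metric m l j x * ofFrame3 T x k i m = (warp k).1 x * (warp i).1 x *
      ∑ m, christoffel metric m l j x * ((warp m).1 x * (T k i m).1 x) := by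
    rw [Finset.mul_sum]
    refine Finset.sum_congr rfl fun m _ => ?_
    simp only [ofFrame3, val_mul]; ring
  rw [nabla3, hpd, Finset.sum_add_distrib, Finset.sum_add_distrib, e0, e1, e2,
    sum_christoffel_mul, sum_christoffel_mul, sum_christoffel_mul]
  simp only [frameCov3, val_mul, val_sub, val_sum, val_add, val_intCast,
    Finset.sum_add_distrib, Derivation.leibniz, smul_eq_mul, coordDeriv_warp, coordDeriv_eq l (T k i j)]
  by_cases hl : l = 0
  · simp only [hl, if_true, val_mul, val_intCast]; ring
  · simp only [hl, if_false]
    have h0 : (0 : smoothFn).1 x = 0 := rfl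
    rw [h0]; ring

theorem inner1_metric (x : Fin 3 → ℝ) (θ η : Fin 3 → ℝ) :
    inner1 metric x (fun i => (warp i).1 x * θ i) (fun i => (warp i).1 x * η i)
      = ∑ i, θ i * η i := by
  simp only [inner1, metric_inv_apply, ite_mul, zero_mul, Finset.sum_ite_eq, Finset.mem_univ,
    if_true]
  refine Finset.sum_congr rfl fun i _ => ?_
  linear_combination (θ i * η i * ((warp i).1 x * (warpInv i).1 x + 1)) * warp_mul_warpInv i x

theorem inner2_metric (x : Fin 3 → ℝ) (a b : Fin 3 → Fin 3 → ℝ) :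
    inner2 metric x a b = ∑ i, ∑ j, ((warpInv i).1 x * (warpInv j).1 x * a i j) *
      ((warpInv i).1 x * (warpInv j).1 x * b i j) := by
  simp only [inner2, metric_inv_apply, ite_mul, mul_ite, zero_mul, mul_zero, Finset.sum_ite_eq,
    Finset.mem_univ, if_true]
  refine Finset.sum_congr rfl fun i _ => Finset.sum_congr rfl fun j _ => ?_
  ring

theorem vol_metric : vol metric = volume := by
  have h : ∀ x, (metric x).det = 1 := by
    intro x
    rw [metric_eq, Matrix.det_diagonal, Fin.prod_univ_three]
    simp [← mul_pow, ← Real.exp_add]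
  simp only [vol, h, Real.sqrt_one, ENNReal.ofReal_one]
  exact withDensity_one

/-! ### Curvature, the linearized operator and the inner products -/

theorem pd_christoffel (a k i j : Fin 3) (x : Fin 3 → ℝ) :
    pd a (christoffel metric k i j) x =
      if a = 0 then conn i j k * (expo i + expo j - expo k)
        * ((warp i).1 x * (warp j).1 x * (warpInv k).1 x) else 0 := by
  have h : christoffel metric k i j = (((if i = 0 ∧ j = k then expo k else 0 : ℤ) : smoothFn)
      + (conn i j k : smoothFn) * (warp i * warp j * warpInv k)).1 := by
    funext y
    rw [christoffel_metric]
    simp only [val_add, val_mul, val_intCast]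
    push_cast
    rfl
  rw [h, ← coordDeriv_apply]
  simp only [map_add, Derivation.leibniz, Derivation.map_intCast, coordDeriv_warp,
    coordDeriv_warpInv, smul_eq_mul, mul_zero, add_zero, zero_add]
  split_ifs
  · simp only [val_add, val_mul, val_neg, val_intCast]; ring
  · simp

theorem warp_zero : warp 0 = 1 :=
  Subtype.ext <| funext fun x => by simp [warp, expo]

set_option maxHeartbeats 1000000 in
theorem curv_metric (i j k l : Fin 3) (x : Fin 3 → ℝ) :
    curv metric i j k l x =
      frameCurv i j k l * ((warp i).1 x * (warp j).1 x * (warp k).1 x * (warpInv l).1 x) := by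
  have h0 : (warp 0).1 x = 1 := by rw [warp_zero]; rfl
  have h0' : (warpInv 0).1 x = 1 := by rw [warpInv_zero]; rfl
  have h1 := warp_mul_warpInv 1 x
  have h2 := warp_mul_warpInv 2 x
  simp only [curv, pd_christoffel, christoffel_metric]
  fin_cases i <;> fin_cases j <;> fin_cases k <;> fin_cases l <;>
    simp [Fin.sum_univ_three, expo, h0, h0', conn, frameCurv, sect] <;> grind

theorem curvLow_metric (i j k l : Fin 3) (x : Fin 3 → ℝ) :
    curvLow metric i j k l x =
      frameCurv i j k l * ((warp i).1 x * (warp j).1 x * (warp k).1 x * (warp l).1 x) := by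
  simp only [curvLow, metric_apply, mul_ite, mul_zero, Finset.sum_ite_eq', Finset.mem_univ,
    if_true, curv_metric]
  linear_combination (frameCurv i j k l * ((warp i).1 x * (warp j).1 x * (warp k).1 x
    * (warp l).1 x)) * warp_mul_warpInv l x

theorem ricci_metric (j k : Fin 3) (x : Fin 3 → ℝ) :
    ricci metric x j k = frameRicci j k * ((warp j).1 x * (warp k).1 x) := by
  simp only [ricci, curv_metric, frameRicci, Int.cast_sum, Finset.sum_mul]
  refine Finset.sum_congr rfl fun i _ => ?_
  linear_combination (frameCurv i j k i * ((warp j).1 x * (warp k).1 x)) * warp_mul_warpInv i x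

theorem roughLaplacian_ofFrame2 (H : Fin 3 → Fin 3 → smoothFn) (x : Fin 3 → ℝ) (i j : Fin 3) :
    roughLaplacian metric (ofFrame2 H) x i j =
      ofFrame2 (fun i j => ∑ k, frameCov3 frameDeriv (frameCov2 frameDeriv H) k k i j) x i j := by
  simp only [roughLaplacian, nabla2_ofFrame2, nabla3_ofFrame3, metric_inv_apply, ite_mul, zero_mul,
    Finset.sum_ite_eq, Finset.mem_univ, if_true, ofFrame2, val_mul, val_sum, Finset.mul_sum]
  refine Finset.sum_congr rfl fun k _ => ?_
  linear_combination ((warp i).1 x * (warp j).1 x *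
    (frameCov3 frameDeriv (frameCov2 frameDeriv H) k k i j).1 x
      * ((warp k).1 x * (warpInv k).1 x + 1)) * warp_mul_warpInv k x

theorem lichnerowicz_ofFrame2 (H : Fin 3 → Fin 3 → smoothFn) :
    lichnerowicz metric (ofFrame2 H) = ofFrame2 (frameLich frameDeriv H) := by
  ext x i j
  have hR : ∑ p, ∑ q, curvLow metric i p q j x *
        (∑ a, ∑ b, (metric x)⁻¹ p a * (metric x)⁻¹ q b * ofFrame2 H x a b) =
      (warp i).1 x * (warp j).1 x * ∑ p, ∑ q, frameCurv i p q j * (H p q).1 x := by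
    simp only [Finset.mul_sum]
    refine Finset.sum_congr rfl fun p _ => Finset.sum_congr rfl fun q _ => ?_
    simp only [metric_inv_apply, ite_mul, mul_ite, zero_mul, mul_zero, Finset.sum_ite_eq,
      Finset.mem_univ, if_true, curvLow_metric, ofFrame2, val_mul]
    have hp := warp_mul_warpInv p x
    have hq := warp_mul_warpInv q x
    calc _ = (warp i).1 x * (warp j).1 x * (frameCurv i p q j * (H p q).1 x) *
          ((warp p).1 x * (warpInv p).1 x) ^ 2 * ((warp q).1 x * (warpInv q).1 x) ^ 2 := by ring
      _ = _ := by rw [hp, hq]; ring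
  have hS : ∀ i k, ∑ l, ricci metric x i l * (metric x)⁻¹ l k =
      frameRicci i k * ((warp i).1 x * (warpInv k).1 x) := by
    intro i k
    simp only [metric_inv_apply, mul_ite, mul_zero, Finset.sum_ite_eq', Finset.mem_univ, if_true,
      ricci_metric]
    linear_combination (frameRicci i k * ((warp i).1 x * (warpInv k).1 x)) * warp_mul_warpInv k x
  have e1 : ∑ k, (∑ l, ricci metric x i l * (metric x)⁻¹ l k) * ofFrame2 H x k j =
      (warp i).1 x * (warp j).1 x * ∑ k, frameRicci i k * (H k j).1 x := by
    rw [Finset.mul_sum]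
    refine Finset.sum_congr rfl fun k _ => ?_
    rw [hS]
    simp only [ofFrame2, val_mul]
    linear_combination ((warp i).1 x * (warp j).1 x * (frameRicci i k * (H k j).1 x))
      * warp_mul_warpInv k x
  have e2 : ∑ k, (∑ l, ricci metric x j l * (metric x)⁻¹ l k) * ofFrame2 H x i k =
      (warp i).1 x * (warp j).1 x * ∑ k, frameRicci j k * (H i k).1 x := by
    rw [Finset.mul_sum]
    refine Finset.sum_congr rfl fun k _ => ?_
    rw [hS]
    simp only [ofFrame2, val_mul]
    linear_combination ((warp i).1 x * (warp j).1 x * (frameRicci j k * (H i k).1 x))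
      * warp_mul_warpInv k x
  rw [lichnerowicz, roughLaplacian_ofFrame2, hR, e1, e2]
  have h2 : (2 : smoothFn).1 x = 2 := rfl
  simp only [ofFrame2, frameLich, val_mul, val_add, val_sub, val_sum, val_intCast, h2]
  ring

theorem pd_field (γ : ℝ) (i k : Fin 3) (x : Fin 3 → ℝ) :
    pd i (fun y => field γ y k) x =
      if i = k then (![0, -4 * (1 - γ), -4 * γ] : Fin 3 → ℝ) i else 0 :=
  congrArg (fun f : smoothFn => f.1 x) (coordDeriv_fieldFn γ i k)

theorem lieDeriv_ofFrame2 (γ : ℝ) (H : Fin 3 → Fin 3 → smoothFn) :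
    lieDeriv (field γ) (ofFrame2 H) = ofFrame2 (frameLie (fieldDeriv γ) H) := by
  ext x i j
  have hpd : ∀ k, pd k (fun y => ofFrame2 H y i j) x =
      (warp i).1 x * (warp j).1 x * (coordDeriv k (H i j)).1 x
        + if k = 0 then ((expo i + expo j) * ofFrame2 H x i j) else 0 := by
    intro k
    change (coordDeriv k (warp i * warp j * H i j)).1 x = _
    simp only [Derivation.leibniz, coordDeriv_warp, smul_eq_mul, ofFrame2]
    split_ifs
    · simp only [val_add, val_mul, val_intCast]; ring
    · simp
  have hX : field γ x 0 = 2 - 4 * γ := by rw [field_eq]; simp; ring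
  simp only [lieDeriv, hpd, pd_field, Finset.sum_add_distrib, mul_add, ite_mul, mul_ite, zero_mul,
    mul_zero, Finset.sum_ite_eq, Finset.sum_ite_eq', Finset.mem_univ, if_true, hX]
  have hF : ∑ k, field γ x k * ((warp i).1 x * (warp j).1 x * (coordDeriv k (H i j)).1 x) =
      (warp i).1 x * (warp j).1 x * (fieldDeriv γ (H i j)).1 x := by
    simp only [fieldDeriv_apply, val_sum, val_mul, Finset.mul_sum]
    refine Finset.sum_congr rfl fun k _ => ?_
    have : (fieldFn γ k).1 x = field γ x k := rfl
    rw [this]; ring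
  rw [hF]
  simp only [ofFrame2, frameLie, val_mul, val_add, val_intCast]
  have hc : ∀ i : Fin 3, (2 - 4 * γ) * (expo i : ℝ) + (![0, -4 * (1 - γ), -4 * γ] : Fin 3 → ℝ) i
      = ((![0, -2, -2] : Fin 3 → ℤ) i : ℝ) := by
    intro i
    fin_cases i <;> simp [expo] <;> ring
  push_cast
  rw [← hc i, ← hc j]
  ring

theorem linOp_ofFrame2 (γ : ℝ) (H : Fin 3 → Fin 3 → smoothFn) :
    linOp metric (field γ) 4 (ofFrame2 H) =
      ofFrame2 (frameLinOp frameDeriv (fieldDeriv γ) H) := by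
  ext x i j
  have h4 : (4 : smoothFn).1 x = 4 := rfl
  simp only [linOp, lichnerowicz_ofFrame2, lieDeriv_ofFrame2, ofFrame2, frameLinOp, val_mul,
    val_sub, h4]
  ring

theorem divergence_ofFrame2 (H : Fin 3 → Fin 3 → smoothFn) (x : Fin 3 → ℝ) (j : Fin 3) :
    divergence metric (ofFrame2 H) x j = (warp j).1 x * (frameDiv frameDeriv H j).1 x := by
  simp only [divergence, nabla2_ofFrame2, metric_inv_apply, ite_mul, zero_mul,
    Finset.sum_ite_eq, Finset.mem_univ, if_true, ofFrame3, frameDiv, val_neg, val_mul, val_sum,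
    Finset.mul_sum, mul_neg]
  congr 1
  refine Finset.sum_congr rfl fun k _ => ?_
  linear_combination ((warp j).1 x * (frameCov2 frameDeriv H k k j).1 x
      * ((warp k).1 x * (warpInv k).1 x + 1)) * warp_mul_warpInv k x

theorem inner2_ofFrame2 (H K : Fin 3 → Fin 3 → smoothFn) (x : Fin 3 → ℝ) :
    inner2 metric x (ofFrame2 H x) (ofFrame2 K x) = (∑ i, ∑ j, H i j * K i j).1 x := by
  simp only [inner2_metric, val_sum, val_mul, ofFrame2]
  refine Finset.sum_congr rfl fun i _ => Finset.sum_congr rfl fun j _ => ?_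
  have hi := warp_mul_warpInv i x
  have hj := warp_mul_warpInv j x
  calc _ = ((warp i).1 x * (warpInv i).1 x) ^ 2 * ((warp j).1 x * (warpInv j).1 x) ^ 2 *
        ((H i j).1 x * (K i j).1 x) := by ring
    _ = _ := by rw [hi, hj]; ring

theorem inner1_divergence (H : Fin 3 → Fin 3 → smoothFn) (x : Fin 3 → ℝ) :
    inner1 metric x (divergence metric (ofFrame2 H) x) (divergence metric (ofFrame2 H) x) =
      (∑ j, frameDiv frameDeriv H j * frameDiv frameDeriv H j).1 x := by
  have : divergence metric (ofFrame2 H) x =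
      fun j => (warp j).1 x * (frameDiv frameDeriv H j).1 x :=
    funext (divergence_ofFrame2 H x)
  rw [this, inner1_metric]
  simp only [val_sum, val_mul]

/-! ### The stability estimate -/

theorem ofFrame2_warpInv (h : (Fin 3 → ℝ) → Fin 3 → Fin 3 → ℝ) (x : Fin 3 → ℝ) (i j : Fin 3) :
    (warp i).1 x * (warp j).1 x * ((warpInv i).1 x * (warpInv j).1 x * h x i j) = h x i j := by
  have hi := warp_mul_warpInv i x
  have hj := warp_mul_warpInv j x
  calc _ = ((warp i).1 x * (warpInv i).1 x) * ((warp j).1 x * (warpInv j).1 x) * h x i j := by ring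
    _ = _ := by rw [hi, hj]; ring

/-- Every test tensor has smooth, compactly supported, symmetric frame components. -/
theorem exists_frame_components {h : (Fin 3 → ℝ) → Fin 3 → Fin 3 → ℝ} (hh : IsTestTensor h) :
    ∃ H : Fin 3 → Fin 3 → smoothFn, (∀ i j, H i j ∈ compactlySupported) ∧
      (∀ i j, H i j = H j i) ∧ ofFrame2 H = h := by
  have hs : ∀ i j, ContDiff ℝ ∞ fun x => h x i j := hh.smooth
  refine ⟨fun i j => warpInv i * warpInv j * ⟨fun x => h x i j, hs i j⟩, fun i j => ?_,
    fun i j => Subtype.ext <| funext fun x => ?_, ?_⟩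
  · refine compactlySupported.mul_mem_left _ ?_
    change HasCompactSupport fun x => h x i j
    exact hh.compactSupport.comp_left (g := fun T : Fin 3 → Fin 3 → ℝ => T i j) rfl
  · change (warpInv i).1 x * (warpInv j).1 x * h x i j = (warpInv j).1 x * (warpInv i).1 x * h x j i
    rw [hh.symm x i j, mul_comm ((warpInv i).1 x)]
  · ext x i j
    exact ofFrame2_warpInv h x i j

variable {H : Fin 3 → Fin 3 → smoothFn}

theorem frameCov2_mem (hH : ∀ i j, H i j ∈ compactlySupported) (k i j : Fin 3) :
    frameCov2 frameDeriv H k i j ∈ compactlySupported :=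
  sub_mem (frameDeriv_mem (hH i j) k) <| sum_mem fun m _ =>
    add_mem (compactlySupported.mul_mem_left _ (hH m j)) (compactlySupported.mul_mem_left _ (hH i m))

theorem frameDiv_mem (hH : ∀ i j, H i j ∈ compactlySupported) (j : Fin 3) :
    frameDiv frameDeriv H j ∈ compactlySupported :=
  neg_mem <| sum_mem fun i _ => frameCov2_mem hH i i j

theorem bochnerField_mem (hH : ∀ i j, H i j ∈ compactlySupported) (k : Fin 3) :
    bochnerField frameDeriv H k ∈ compactlySupported :=
  sub_mem (sum_mem fun i _ => sum_mem fun j _ => compactlySupported.mul_mem_left _ (hH i j))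
    (sum_mem fun j _ => compactlySupported.mul_mem_left _ (hH k j))

theorem sum_mul_mem (K : Fin 3 → Fin 3 → smoothFn) (hH : ∀ i j, H i j ∈ compactlySupported) :
    ∑ i, ∑ j, K i j * H i j ∈ compactlySupported :=
  sum_mem fun i _ => sum_mem fun j _ => compactlySupported.mul_mem_left _ (hH i j)

/-- The pointwise spectral bound: `-(5 - √17) / 2` is the largest eigenvalue of the reaction form.
On diagonal tensors the form completes to squares because `ω² - 5 ω + 2 = 0`. -/
theorem reaction_le (hsymm : ∀ i j, H i j = H j i) (x : Fin 3 → ℝ) :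
    (reaction H).1 x ≤ -((5 - Real.sqrt 17) / 2) * (∑ i, ∑ j, H i j * H i j).1 x := by
  have h10 := hsymm 1 0
  have h20 := hsymm 2 0
  have h21 := hsymm 2 1
  have hn : (-2 : smoothFn).1 x = -2 := rfl
  have h2 : (2 : smoothFn).1 x = 2 := rfl
  simp only [reaction, Fin.sum_univ_three, h10, h20, h21, val_add, val_sub, val_mul, hn, h2]
  generalize (H 0 0).1 x = a
  generalize (H 1 1).1 x = b
  generalize (H 2 2).1 x = c
  generalize (H 0 1).1 x = p
  generalize (H 0 2).1 x = q
  generalize (H 1 2).1 x = r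
  have hs : Real.sqrt 17 ^ 2 = 17 := Real.sq_sqrt (by norm_num)
  have hs4 : 4 < Real.sqrt 17 := by
    rw [show (4 : ℝ) = Real.sqrt 16 by rw [show (16 : ℝ) = 4 ^ 2 by norm_num]; simp]
    exact Real.sqrt_lt_sqrt (by norm_num) (by norm_num)
  generalize Real.sqrt 17 = s at hs hs4
  have hdiag : 0 ≤ ((3 + s) / 2) * ((3 + s) / 2 * a ^ 2 + 2 * a * (b + c)
      + (s - 3) / 4 * (b + c) ^ 2 + (1 + s) / 4 * (b - c) ^ 2) := by
    have : ((3 + s) / 2) * ((3 + s) / 2 * a ^ 2 + 2 * a * (b + c)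
        + (s - 3) / 4 * (b + c) ^ 2 + (1 + s) / 4 * (b - c) ^ 2) =
        ((3 + s) / 2 * a + (b + c)) ^ 2 + ((3 + s) / 2) * ((1 + s) / 4) * (b - c) ^ 2 := by
      linear_combination ((b + c) ^ 2 / 8) * hs
    rw [this]; positivity
  have hdiag' := nonneg_of_mul_nonneg_right hdiag (by linarith)
  nlinarith [mul_nonneg (by linarith : (0 : ℝ) ≤ s - 1) (sq_nonneg p),
    mul_nonneg (by linarith : (0 : ℝ) ≤ s - 1) (sq_nonneg q),
    mul_nonneg (by linarith : (0 : ℝ) ≤ s - 1) (sq_nonneg r), sq_nonneg r]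

/-- The stability estimate in frame components: integrate the Koiso-type identity, in which the
divergence terms vanish. -/
theorem integral_frameLinOp_le (γ : ℝ) (hH : ∀ i j, H i j ∈ compactlySupported)
    (hsymm : ∀ i j, H i j = H j i) :
    ∫ x, (∑ i, ∑ j, frameLinOp frameDeriv (fieldDeriv γ) H i j * H i j).1 x ≤
      -(∫ x, (∑ j, frameDiv frameDeriv H j * frameDiv frameDeriv H j).1 x)
        - (5 - Real.sqrt 17) / 2 * ∫ x, (∑ i, ∑ j, H i j * H i j).1 x := by
  have key := koiso_identity frameDeriv (fieldDeriv γ) frameDeriv_zero_one frameDeriv_zero_two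
    frameDeriv_one_two H hsymm
  have hR := fun x => reaction_le hsymm x
  have hL := sum_mul_mem (frameLinOp frameDeriv (fieldDeriv γ) H) hH
  have hN := sum_mul_mem H hH
  have hD : ∑ j, frameDiv frameDeriv H j * frameDiv frameDeriv H j ∈ compactlySupported :=
    sum_mem fun j _ => compactlySupported.mul_mem_left _ (frameDiv_mem hH j)
  have hT : ∀ x, 0 ≤ (∑ i, ∑ j, ∑ k,
      (frameCov2 frameDeriv H k i j - frameCov2 frameDeriv H i k j) ^ 2).1 x := by
    intro x
    simp only [val_sum]
    exact Finset.sum_nonneg fun i _ => Finset.sum_nonneg fun j _ => Finset.sum_nonneg fun k _ =>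
      sq_nonneg ((frameCov2 frameDeriv H k i j - frameCov2 frameDeriv H i k j).1 x)
  have hV : ∀ k, frameDeriv k (bochnerField frameDeriv H k) ∈ compactlySupported :=
    fun k => frameDeriv_mem (bochnerField_mem hH k) k
  have hV0 : ∫ x, (∑ k, frameDeriv k (bochnerField frameDeriv H k)).1 x = 0 := by
    simp only [val_sum]
    rw [integral_finsetSum _ fun k _ => integrable_of_mem (hV k)]
    exact Finset.sum_eq_zero fun k _ => integral_frameDeriv (bochnerField_mem hH k) k
  have hX0 := integral_fieldDeriv hN γ
  have hXm : fieldDeriv γ (∑ i, ∑ j, H i j * H i j) - 4 * ∑ i, ∑ j, H i j * H i j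
      ∈ compactlySupported := by
    refine sub_mem ?_ (compactlySupported.mul_mem_left _ hN)
    rw [fieldDeriv_apply]
    exact sum_mem fun k _ => compactlySupported.mul_mem_left _ (coordDeriv_mem hN k)
  have hVm : ∑ k, frameDeriv k (bochnerField frameDeriv H k) ∈ compactlySupported :=
    sum_mem fun k _ => hV k
  generalize ∑ i, ∑ j, ∑ k, (frameCov2 frameDeriv H k i j - frameCov2 frameDeriv H i k j) ^ 2 = t
    at *
  generalize fieldDeriv γ (∑ i, ∑ j, H i j * H i j) - 4 * ∑ i, ∑ j, H i j * H i j = y at *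
  generalize ∑ i, ∑ j, frameLinOp frameDeriv (fieldDeriv γ) H i j * H i j = l at *
  generalize ∑ i, ∑ j, H i j * H i j = n at *
  generalize ∑ j, frameDiv frameDeriv H j * frameDiv frameDeriv H j = d at *
  generalize ∑ k, frameDeriv k (bochnerField frameDeriv H k) = v at *
  have hpt : ∀ x, l.1 x ≤ -d.1 x - (5 - Real.sqrt 17) / 2 * n.1 x + v.1 x - 1 / 2 * y.1 x := by
    intro x
    have := congrArg (fun f : smoothFn => f.1 x) key
    have h2 : (2 : smoothFn).1 x = 2 := rfl
    simp only [val_add, val_sub, val_mul, h2] at this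
    linarith [hR x, hT x]
  have i1 := (integrable_of_mem hD).neg
  have i2 := (integrable_of_mem hN).const_mul ((5 - Real.sqrt 17) / 2)
  have i3 := integrable_of_mem hVm
  have i4 := (integrable_of_mem hXm).const_mul (1 / 2)
  refine (integral_mono (integrable_of_mem hL) (((i1.sub i2).add i3).sub i4) hpt).trans ?_
  rw [integral_sub' ((i1.sub i2).add i3) i4, integral_add' (i1.sub i2) i3, integral_sub' i1 i2,
    integral_const_mul, integral_const_mul, hV0, hX0]
  simp [integral_neg]

theorem integrable_inner2_linOp (γ : ℝ) {h k : (Fin 3 → ℝ) → Fin 3 → Fin 3 → ℝ}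
    (hh : IsTestTensor h) (hk : IsTestTensor k) :
    Integrable (fun x => inner2 metric x (linOp metric (field γ) 4 h x) (k x)) (vol metric) := by
  obtain ⟨H, -, -, rfl⟩ := exists_frame_components hh
  obtain ⟨K, hK, -, rfl⟩ := exists_frame_components hk
  simp only [linOp_ofFrame2, inner2_ofFrame2, vol_metric]
  exact integrable_of_mem (sum_mul_mem _ hK)

theorem integrable_inner2 {h k : (Fin 3 → ℝ) → Fin 3 → Fin 3 → ℝ}
    (hh : IsTestTensor h) (hk : IsTestTensor k) :
    Integrable (fun x => inner2 metric x (h x) (k x)) (vol metric) := by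
  obtain ⟨H, -, -, rfl⟩ := exists_frame_components hh
  obtain ⟨K, hK, -, rfl⟩ := exists_frame_components hk
  simp only [inner2_ofFrame2, vol_metric]
  exact integrable_of_mem (sum_mul_mem _ hK)

theorem integral_linOp_le (γ : ℝ) {h : (Fin 3 → ℝ) → Fin 3 → Fin 3 → ℝ} (hh : IsTestTensor h) :
    ∫ x, inner2 metric x (linOp metric (field γ) 4 h x) (h x) ∂(vol metric)
      ≤ -(∫ x, inner1 metric x (divergence metric h x) (divergence metric h x) ∂(vol metric))
        - (5 - Real.sqrt 17) / 2 * ∫ x, inner2 metric x (h x) (h x) ∂(vol metric) := by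
  obtain ⟨H, hH, hsymm, rfl⟩ := exists_frame_components hh
  simp only [linOp_ofFrame2, inner2_ofFrame2, inner1_divergence, vol_metric]
  exact integral_frameLinOp_le γ hH hsymm

theorem inner1_self_nonneg (x : Fin 3 → ℝ) (θ : Fin 3 → ℝ) : 0 ≤ inner1 metric x θ θ := by
  have : θ = fun i => (warp i).1 x * ((warpInv i).1 x * θ i) := by
    funext i
    rw [← mul_assoc, warp_mul_warpInv, one_mul]
  rw [this, inner1_metric]
  exact Finset.sum_nonneg fun i _ => mul_self_nonneg _

theorem omega_pos : 0 < (5 - Real.sqrt 17) / 2 := by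
  have : Real.sqrt 17 < 5 := (Real.sqrt_lt' (by norm_num)).2 (by norm_num)
  linarith

/-! ### Complexification and density -/

theorem inner2C_metric (x : Fin 3 → ℝ) (a b : Fin 3 → Fin 3 → ℂ) :
    inner2C metric x a b = ∑ i, ∑ j, ((((warpInv i).1 x * (warpInv j).1 x) ^ 2 : ℝ) : ℂ) *
      a i j * (starRingEnd ℂ) (b i j) := by
  have h : ∀ i j k l : Fin 3, (((metric x)⁻¹ i k * (metric x)⁻¹ j l : ℝ) : ℂ) =
      if i = k then if j = l then ((((warpInv i).1 x * (warpInv j).1 x) ^ 2 : ℝ) : ℂ) else 0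
      else 0 := by
    intro i j k l
    rw [metric_inv_apply, metric_inv_apply]
    split_ifs <;> simp [mul_pow]
  simp only [inner2C, h, ite_mul, zero_mul]
  refine Finset.sum_congr rfl fun i _ => Finset.sum_congr rfl fun j _ => ?_
  simp

theorem re_inner2C (x : Fin 3 → ℝ) (a b : Fin 3 → Fin 3 → ℂ) :
    (inner2C metric x a b).re = inner2 metric x (fun i j => (a i j).re) (fun i j => (b i j).re)
      + inner2 metric x (fun i j => (a i j).im) (fun i j => (b i j).im) := by
  simp only [inner2C_metric, inner2_metric, Complex.re_sum, ← Finset.sum_add_distrib]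
  refine Finset.sum_congr rfl fun i _ => Finset.sum_congr rfl fun j _ => ?_
  simp only [Complex.mul_re, Complex.mul_im, Complex.ofReal_re, Complex.ofReal_im, Complex.conj_re,
    Complex.conj_im]
  ring

theorem im_inner2C (x : Fin 3 → ℝ) (a b : Fin 3 → Fin 3 → ℂ) :
    (inner2C metric x a b).im = inner2 metric x (fun i j => (a i j).im) (fun i j => (b i j).re)
      - inner2 metric x (fun i j => (a i j).re) (fun i j => (b i j).im) := by
  simp only [inner2C_metric, inner2_metric, Complex.im_sum, ← Finset.sum_sub_distrib]
  refine Finset.sum_congr rfl fun i _ => Finset.sum_congr rfl fun j _ => ?_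
  simp only [Complex.mul_re, Complex.mul_im, Complex.ofReal_re, Complex.ofReal_im, Complex.conj_re,
    Complex.conj_im]
  ring

theorem isTestTensor_re {u : (Fin 3 → ℝ) → Fin 3 → Fin 3 → ℂ} (hu : IsTestTensor u) :
    IsTestTensor fun x i j => (u x i j).re where
  smooth i j := Complex.reCLM.contDiff.comp (hu.smooth i j)
  compactSupport := hu.compactSupport.comp_left
    (g := fun T : Fin 3 → Fin 3 → ℂ => fun i j => (T i j).re) rfl
  symm x i j := by rw [hu.symm x i j]

theorem isTestTensor_im {u : (Fin 3 → ℝ) → Fin 3 → Fin 3 → ℂ} (hu : IsTestTensor u) :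
    IsTestTensor fun x i j => (u x i j).im where
  smooth i j := Complex.imCLM.contDiff.comp (hu.smooth i j)
  compactSupport := hu.compactSupport.comp_left
    (g := fun T : Fin 3 → Fin 3 → ℂ => fun i j => (T i j).im) rfl
  symm x i j := by rw [hu.symm x i j]

theorem integral_re_of_integrable {f : (Fin 3 → ℝ) → ℂ} {μ : Measure (Fin 3 → ℝ)}
    (hre : Integrable (fun x => (f x).re) μ) (him : Integrable (fun x => (f x).im) μ) :
    (∫ x, f x ∂μ).re = ∫ x, (f x).re ∂μ := by
  have : Integrable f μ := by
    have h := hre.ofReal (𝕜 := ℂ) |>.add (him.ofReal (𝕜 := ℂ) |>.mul_const Complex.I)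
    refine h.congr (Filter.Eventually.of_forall fun x => ?_)
    exact Complex.re_add_im (f x)
  exact (integral_re (𝕜 := ℂ) this).symm

theorem re_integral_linOpC_le (γ : ℝ) {u : (Fin 3 → ℝ) → Fin 3 → Fin 3 → ℂ}
    (hu : IsTestTensor u) :
    (∫ x, inner2C metric x (linOpC metric (field γ) 4 u x) (u x) ∂(vol metric)).re
      ≤ -((5 - Real.sqrt 17) / 2) * (∫ x, inner2C metric x (u x) (u x) ∂(vol metric)).re := by
  have hv := isTestTensor_re hu
  have hw := isTestTensor_im hu
  have hre : ∀ x, (fun i j => (linOpC metric (field γ) 4 u x i j).re) =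
      linOp metric (field γ) 4 (fun y a b => (u y a b).re) x := by
    intro x; ext i j; simp [linOpC]
  have him : ∀ x, (fun i j => (linOpC metric (field γ) 4 u x i j).im) =
      linOp metric (field γ) 4 (fun y a b => (u y a b).im) x := by
    intro x; ext i j; simp [linOpC]
  have key : ∀ h : (Fin 3 → ℝ) → Fin 3 → Fin 3 → ℝ, IsTestTensor h →
      ∫ x, inner2 metric x (linOp metric (field γ) 4 h x) (h x) ∂(vol metric) ≤
        -((5 - Real.sqrt 17) / 2) * ∫ x, inner2 metric x (h x) (h x) ∂(vol metric) := by
    intro h hh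
    have h1 := integral_linOp_le γ hh
    have h2 : 0 ≤ ∫ x, inner1 metric x (divergence metric h x) (divergence metric h x)
        ∂(vol metric) := integral_nonneg fun x => inner1_self_nonneg x _
    linarith
  rw [integral_re_of_integrable, integral_re_of_integrable]
  · simp only [re_inner2C, hre, him]
    rw [integral_add (integrable_inner2_linOp γ hv hv) (integrable_inner2_linOp γ hw hw),
      integral_add (integrable_inner2 hv hv) (integrable_inner2 hw hw)]
    linarith [key _ hv, key _ hw]
  · simp only [re_inner2C]
    exact (integrable_inner2 hv hv).add (integrable_inner2 hw hw)
  · simp only [im_inner2C]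
    exact (integrable_inner2 hw hv).sub (integrable_inner2 hv hw)
  · simp only [re_inner2C, hre, him]
    exact (integrable_inner2_linOp γ hv hv).add (integrable_inner2_linOp γ hw hw)
  · simp only [im_inner2C, hre, him]
    exact (integrable_inner2_linOp γ hw hv).sub (integrable_inner2_linOp γ hv hw)

theorem re_inner2C_self (x : Fin 3 → ℝ) (a : Fin 3 → Fin 3 → ℂ) :
    (inner2C metric x a a).re =
      ∑ i, ∑ j, ‖(((warpInv i).1 x * (warpInv j).1 x : ℝ) : ℂ) * a i j‖ ^ 2 := by
  simp only [inner2C_metric, Complex.re_sum]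
  refine Finset.sum_congr rfl fun i _ => Finset.sum_congr rfl fun j _ => ?_
  rw [mul_assoc, Complex.mul_conj, ← Complex.ofReal_mul, Complex.ofReal_re, norm_mul,
    Complex.norm_real, Real.norm_eq_abs, mul_pow |_|, sq_abs, Complex.normSq_eq_norm_sq]

/-- Density of the test tensors in `L²`: approximate the frame components. -/
theorem exists_testTensor_near {f : (Fin 3 → ℝ) → Fin 3 → Fin 3 → ℂ} (hf : Measurable f)
    (hsymm : ∀ x i j, f x i j = f x j i)
    (hfin : ∫⁻ x, ENNReal.ofReal (inner2C metric x (f x) (f x)).re ∂(vol metric) < ⊤)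
    {ε : ℝ} (hε : 0 < ε) :
    ∃ u : (Fin 3 → ℝ) → Fin 3 → Fin 3 → ℂ, IsTestTensor u ∧
      ∫⁻ x, ENNReal.ofReal (inner2C metric x (f x - u x) (f x - u x)).re ∂(vol metric)
        < ENNReal.ofReal ε := by
  rw [vol_metric] at *
  let F : Fin 3 → Fin 3 → (Fin 3 → ℝ) → ℂ :=
    fun i j x => (((warpInv i).1 x * (warpInv j).1 x : ℝ) : ℂ) * f x i j
  have hFsymm : ∀ i j, F i j = F j i := by
    intro i j; funext x
    simp only [F, hsymm x i j, mul_comm ((warpInv i).1 x)]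
  have hFmeas : ∀ i j, Measurable (F i j) := by
    intro i j
    refine Measurable.mul ?_ ((measurable_pi_apply j).comp ((measurable_pi_apply i).comp hf))
    exact Complex.measurable_ofReal.comp (((contDiff_val (warpInv i)).continuous.measurable).mul
      ((contDiff_val (warpInv j)).continuous.measurable))
  have hFL : ∀ i j, MemLp (F i j) 2 volume := by
    intro i j
    refine (memLp_two_iff_integrable_sq_norm (hFmeas i j).aestronglyMeasurable).2
      ⟨((hFmeas i j).norm.pow_const 2).aestronglyMeasurable, ?_⟩
    rw [hasFiniteIntegral_iff_ofReal (Filter.Eventually.of_forall fun x => sq_nonneg _)]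
    refine lt_of_le_of_lt (lintegral_mono fun x => ENNReal.ofReal_le_ofReal ?_) hfin
    rw [re_inner2C_self]
    refine le_trans ?_ (Finset.single_le_sum (f := fun i => ∑ j,
      ‖(((warpInv i).1 x * (warpInv j).1 x : ℝ) : ℂ) * f x i j‖ ^ 2)
      (fun i _ => Finset.sum_nonneg fun j _ => sq_nonneg _) (Finset.mem_univ i))
    exact Finset.single_le_sum (f := fun j =>
      ‖(((warpInv i).1 x * (warpInv j).1 x : ℝ) : ℂ) * f x i j‖ ^ 2)
      (fun j _ => sq_nonneg _) (Finset.mem_univ j)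
  -- nine components, each contributing at most `ε / 10` to the squared distance
  obtain ⟨η, hη, hηε⟩ : ∃ η : ℝ, 0 < η ∧ η ^ 2 = ε / 10 :=
    ⟨Real.sqrt (ε / 10), Real.sqrt_pos.2 (by positivity), Real.sq_sqrt (by positivity)⟩
  have hG : ∀ i j, ∃ g : (Fin 3 → ℝ) → ℂ, HasCompactSupport g ∧ ContDiff ℝ ∞ g ∧
      eLpNorm (F i j - g) 2 volume ≤ ENNReal.ofReal η := fun i j =>
    (hFL i j).exist_eLpNorm_sub_le (by simp) (by norm_num) hη
  choose G hGc hGs hGn using hG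
  -- choosing the approximants for `i ≤ j` only keeps the tensor symmetric
  let K : Fin 3 → Fin 3 → (Fin 3 → ℝ) → ℂ := fun i j => G (min i j) (max i j)
  have hKn : ∀ i j, eLpNorm (F i j - K i j) 2 volume ≤ ENNReal.ofReal η := by
    intro i j
    have : F i j = F (min i j) (max i j) := by
      rcases le_total i j with h | h
      · simp [h]
      · simp [h, hFsymm i j]
    rw [this]
    exact hGn _ _
  let u : (Fin 3 → ℝ) → Fin 3 → Fin 3 → ℂ :=
    fun x i j => (((warp i).1 x * (warp j).1 x : ℝ) : ℂ) * K i j x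
  have hu : IsTestTensor u := by
    refine ⟨fun i j => ?_, ?_, fun x i j => ?_⟩
    · exact (Complex.ofRealCLM.contDiff.comp
        ((contDiff_val (warp i)).mul (contDiff_val (warp j)))).mul (hGs _ _)
    · have hc : IsCompact (⋃ i, ⋃ j, tsupport (G i j)) :=
        isCompact_iUnion fun i => isCompact_iUnion fun j => hGc i j
      refine HasCompactSupport.intro hc fun x hx => ?_
      ext i j
      have : K i j x = 0 := image_eq_zero_of_notMem_tsupport fun h =>
        hx (Set.mem_iUnion.2 ⟨_, Set.mem_iUnion.2 ⟨_, h⟩⟩)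
      simp [u, this]
    · simp only [u, K, min_comm i j, max_comm i j, mul_comm ((warp i).1 x)]
  refine ⟨u, hu, ?_⟩
  have hpt : ∀ x, ENNReal.ofReal (inner2C metric x (f x - u x) (f x - u x)).re =
      ∑ i, ∑ j, ‖(F i j - K i j) x‖ₑ ^ 2 := by
    intro x
    rw [re_inner2C_self, ENNReal.ofReal_sum_of_nonneg fun i _ =>
      Finset.sum_nonneg fun j _ => sq_nonneg _]
    refine Finset.sum_congr rfl fun i _ => ?_
    rw [ENNReal.ofReal_sum_of_nonneg fun j _ => sq_nonneg _]
    refine Finset.sum_congr rfl fun j _ => ?_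
    rw [ENNReal.ofReal_pow (norm_nonneg _), ofReal_norm]
    congr 2
    have hi := warp_mul_warpInv i x
    have hj := warp_mul_warpInv j x
    have h1 : (((warpInv i).1 x * (warpInv j).1 x : ℝ) : ℂ)
        * (((warp i).1 x * (warp j).1 x : ℝ) : ℂ) = 1 := by
      rw [← Complex.ofReal_mul, show (warpInv i).1 x * (warpInv j).1 x *
        ((warp i).1 x * (warp j).1 x) = ((warp i).1 x * (warpInv i).1 x) *
        ((warp j).1 x * (warpInv j).1 x) by ring, hi, hj]
      simp
    simp only [Pi.sub_apply, F, u, mul_sub, ← mul_assoc, h1, one_mul]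
  have hmeas : ∀ i j, Measurable fun x => ‖(F i j - K i j) x‖ₑ ^ 2 := fun i j =>
    (((hFmeas i j).sub (hGs _ _).continuous.measurable).enorm.pow_const 2)
  simp only [hpt]
  rw [lintegral_finsetSum _ fun i _ => Finset.measurable_sum _ fun j _ => hmeas i j]
  simp only [lintegral_finsetSum _ fun j _ => hmeas _ j]
  have hle : ∀ i j, ∫⁻ x, ‖(F i j - K i j) x‖ₑ ^ 2 ≤ ENNReal.ofReal (ε / 10) := by
    intro i j
    have h1 : eLpNorm (F i j - K i j) 2 volume ^ 2 = ∫⁻ x, ‖(F i j - K i j) x‖ₑ ^ 2 := by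
      have := eLpNorm_nnreal_pow_eq_lintegral (μ := volume) (f := F i j - K i j) (p := 2) (by simp)
      simpa using this
    rw [← h1, ← hηε, ENNReal.ofReal_pow hη.le]
    exact pow_le_pow_left' (hKn i j) 2
  refine lt_of_le_of_lt (Finset.sum_le_sum fun i _ => Finset.sum_le_sum fun j _ => hle i j) ?_
  simp only [Finset.sum_const, Finset.card_univ, Fintype.card_fin, smul_smul]
  rw [← ENNReal.ofReal_nsmul]
  refine (ENNReal.ofReal_lt_ofReal_iff hε).2 ?_
  simp only [nsmul_eq_mul]
  norm_num
  linarith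

end Sol3

theorem proposition4p3 (γ : ℝ) :
    CoordGeom.StrictlyLinearlyStable Sol3.metric (Sol3.field γ) 4 ∧
    0 < (5 - Real.sqrt 17) / 2 ∧
    ∀ h : (Fin 3 → ℝ) → Fin 3 → Fin 3 → ℝ, CoordGeom.IsTestTensor h →
      ∫ x, CoordGeom.inner2 Sol3.metric x
          (CoordGeom.linOp Sol3.metric (Sol3.field γ) 4 h x) (h x)
          ∂(CoordGeom.vol Sol3.metric)
        ≤ -(∫ x, CoordGeom.inner1 Sol3.metric x (CoordGeom.divergence Sol3.metric h x)
              (CoordGeom.divergence Sol3.metric h x) ∂(CoordGeom.vol Sol3.metric))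
          - (5 - Real.sqrt 17) / 2 *
            ∫ x, CoordGeom.inner2 Sol3.metric x (h x) (h x)
              ∂(CoordGeom.vol Sol3.metric) :=
  ⟨⟨fun _ hf hsymm hfin _ hε => Sol3.exists_testTensor_near hf hsymm hfin hε,
      _, Sol3.omega_pos, fun _ hu => Sol3.re_integral_linOpC_le γ hu⟩,
    Sol3.omega_pos, fun _ hh => Sol3.integral_linOp_le γ hh⟩
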